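/- Let $A$ be a countable set with the discrete topology, let $\mathcal X^-=A^{\{\dots,-2,-1\}}$ be the set of left-infinite sequences with the product topology, and let $g:A\times\mathcal X^-\to[0,1]$ be a probability kernel, i.e. $\sum_{a\in A}g(a|x)=1$ for every $x\in\mathcal X^-$. Assume that $x\mapsto g(a|x)$ is continuous for every $a\in A$. For $j\ge 1$ let $$\mathrm{Osc}_j(g)=\sup\Big\{\tfrac12\sum_{a\in A}|g(a|z)-g(a|z')| : z,z'\in\mathcal X^-,\ z_k=z'_k\ \text{for all } k\ne -j\Big\},\qquad \Delta(g)=1-\sum_{j\ge 1}\mathrm{Osc}_j(g),$$ and assume $\Delta(g)>0$. Let $\mu$ be a shift-invariant probability measure on $A^{\mathbb Z}$ that is compatible with $g$: for all $n\in\mathbb Z$ and $a\in A$, the conditional $\mu$-probability of $\{\omega_n=a\}$ given $(\omega_i)_{i<n}$ equals $g(a|\dots\omega_{n-2}\omega_{n-1})$ $\mu$-almost everywhere. Let $n\ge 0$ and $f:A^{n+1}\to\mathbb R$ be such that, for $0\le j\le n$, the oscillation $$\delta_j(f)=\sup\{|f(\omega)-f(\omega')| : \omega,\omega'\in A^{n+1},\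 \omega_i=\omega'_i\ \text{for all } i\neq j\}$$ is finite; put $\|\underline{\delta}(f)\|_2^2=\sum_{j=0}^n\delta_j(f)^2$, and regard $f$ as the function $\omega\mapsto f(\omega_0,\dots,\omega_n)$ on $A^{\mathbb Z}$. Then $f$ and $e^{\theta f}$ $(\theta\in\mathbb R)$ are $\mu$-integrable, for every $\theta\in\mathbb R$ $$\mathbb E_\mu\big[e^{\theta(f-\mathbb E_\mu[f])}\big]\le \exp\Big(\frac{\theta^2\,\Delta(g)^{-2}}{8}\,\|\underline{\delta}(f)\|_2^2\Big),$$ and for every $u>0$ $$\mu\big(|f-\mathbb E_\mu[f]|>u\big)\le 2\exp\Big(-\frac{2u^2}{\Delta(g)^{-2}\,\|\underline{\delta}(f)\|_2^2}\Big),$$ where the right-hand side is read as $0$ if $\|\underline{\delta}(f)\|_2=0$. -/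

import Mathlib

open MeasureTheory
open scoped ENNReal

noncomputable section

namespace SCUM

/-- A left-infinite sequence `(…, x₋₂, x₋₁)` over the alphabet `A`. The entry `x k` is the symbol at
position `-(k + 1)`, so that `x 0` is the most recent symbol. -/
abbrev Past (A : Type*) := ℕ → A

/-- A (shift-invariant) probability kernel `g(a | x)`. -/
structure PastKernel (A : Type*) where
  /-- The probability `g(a | x)` of the symbol `a` given the past `x`. -/
  prob : A → Past A → ℝ
  nonneg : ∀ a x, 0 ≤ prob a x
  hasSum_one : ∀ x, HasSum (fun a => prob a x) 1

/-- Continuity of the kernel in the past, for the product topology on pasts. -/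
def PastKernel.IsContinuous {A : Type*} [TopologicalSpace A] (g : PastKernel A) : Prop :=
  ∀ a, Continuous (g.prob a)

/-- The oscillation of order `j ≥ 1`: the supremum of the total variation distance between
`g(· | z)` and `g(· | z')` over pasts that agree at every position except possibly `-j`. -/
def PastKernel.Osc {A : Type*} (g : PastKernel A) (j : ℕ) : ℝ≥0∞ :=
  ⨆ (z : Past A) (z' : Past A) (_ : ∀ k : ℕ, k + 1 ≠ j → z k = z' k),
    (1 / 2) * ∑' a, ENNReal.ofReal |g.prob a z - g.prob a z'|

/-- `Δ(g) = 1 - ∑_{j ≥ 1} Osc_j(g)`, an element of `[-∞, 1]`. -/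
def PastKernel.Delta {A : Type*} (g : PastKernel A) : EReal :=
  1 - ((∑' j : ℕ, g.Osc (j + 1) : ℝ≥0∞) : EReal)

/-- The past `(…, ω_{n-2}, ω_{n-1})` of the bi-infinite sequence `ω` strictly before time `n`. -/
def pastAt {A : Type*} (n : ℤ) (ω : ℤ → A) : Past A := fun k => ω (n - 1 - (k : ℤ))

/-- The σ-algebra generated by the coordinates strictly before time `n`. -/
abbrev pastSigma (A : Type*) [MeasurableSpace A] (n : ℤ) : MeasurableSpace (ℤ → A) :=
  ⨆ (i : ℤ) (_ : i ≤ n - 1), MeasurableSpace.comap (fun ω : ℤ → A => ω i) inferInstance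

/-- `μ` is compatible with `g`: for all `n` and `a`, the conditional probability of `{ω_n = a}`
given the coordinates before time `n` is `g(a | past)`, almost everywhere. -/
def IsCompatible {A : Type*} [MeasurableSpace A] (μ : Measure (ℤ → A)) (g : PastKernel A) : Prop :=
  ∀ (n : ℤ) (a : A),
    μ[Set.indicator {ω : ℤ → A | ω n = a} (fun _ => (1 : ℝ)) | pastSigma A n]
      =ᵐ[μ] fun ω => g.prob a (pastAt n ω)

/-- The shift `(Tω)_i = ω_{i+1}`. -/
def shift {A : Type*} (ω : ℤ → A) : ℤ → A := fun i => ω (i + 1)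

/-- The oscillation `δ_j(f)` of `f : A^{n+1} → ℝ` in its `j`-th coordinate. -/
def delta {A : Type*} {n : ℕ} (f : (Fin (n + 1) → A) → ℝ) (j : Fin (n + 1)) : ℝ≥0∞ :=
  ⨆ (ω : Fin (n + 1) → A) (a : A) (b : A),
    ENNReal.ofReal |f (Function.update ω j a) - f (Function.update ω j b)|

/-- The class of functions of `n + 1` symbols all of whose oscillations are finite. -/
def localClass (A : Type*) (n : ℕ) : Set ((Fin (n + 1) → A) → ℝ) :=
  {f | ∀ j, delta f j < ∞}

/-- `‖δ(f)‖₂² = ∑_j δ_j(f)²`, for `f` with finite oscillations. -/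
def deltaNormSq {A : Type*} {n : ℕ} (f : (Fin (n + 1) → A) → ℝ) : ℝ :=
  ∑ j, (delta f j).toReal ^ 2

/-- A function of `n + 1` symbols seen as a function of `ω_0, …, ω_n`. -/
def onSeq {A : Type*} {n : ℕ} (f : (Fin (n + 1) → A) → ℝ) (ω : ℤ → A) : ℝ :=
  f fun i => ω ((i : ℕ) : ℤ)

end SCUM

end

/-! Average out the symbols from the most recent one backwards. Let `L` be the transfer operator of
`g` and regard `f` as a function `h` of the past before time `n + 1`. Compatibility gives `E[h(past
at m + 1)] = E[(L h)(past at m)]`. If `h` has oscillations `d`, Hoeffding's lemma under `g(· | x)`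
gives `L e^{θh} ≤ exp(θ L h + θ² (d 0)² / 8)`, so removing one symbol costs only its squared
oscillation.

The oscillations of `L h` are at most `d (k + 1) + O k * d 0`, where `O` are those of the kernel:
the past acts through `h` and through the law of the new symbol (`HasOscBound.transfer`). Let `c t`
be the entry at 0 after `t` such steps. Then `E e^{θh} ≤ exp(θ²/8 ∑_{s<t} (c s)²) E e^{θ L^t h}`.
Two facts about the recursion finish the proof: `∑ (c s)² ≤ Δ⁻² ∑ (d k)²`
(`sum_sq_iterate_oscStep_le`), and the total oscillation of `L^t h` tends to 0
(`tendsto_tsum_iterate_oscStep`), so that `L^t h` converges uniformly to `E h`. The tail bound is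
Chernoff's. -/

namespace SCUM

/-! ### The oscillation recursion as a renewal equation -/

section Sequences

open Filter Topology

/-- One step of the recursion that bounds the oscillations of a function of the past when the most
recent symbol is averaged out by a kernel with oscillations `O`. -/
def oscStep (O d : ℕ → ℝ) : ℕ → ℝ := fun k => d (k + 1) + O k * d 0

variable {O d : ℕ → ℝ}

theorem oscStep_nonneg (hO : ∀ k, 0 ≤ O k) (hd : ∀ k, 0 ≤ d k) (k : ℕ) : 0 ≤ oscStep O d k :=
  add_nonneg (hd _) (mul_nonneg (hO _) (hd _))

theorem summable_oscStep (hO : Summable O) (hd : Summable d) : Summable (oscStep O d) :=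
  ((summable_nat_add_iff 1).2 hd).add (hO.mul_right _)

theorem tsum_oscStep (hO : Summable O) (hd : Summable d) :
    ∑' k, oscStep O d k = ∑' k, d k - (1 - ∑' k, O k) * d 0 := by
  have h1 : Summable fun k => d (k + 1) := (summable_nat_add_iff 1).2 hd
  unfold oscStep
  rw [h1.tsum_add (hO.mul_right _), tsum_mul_right, hd.tsum_eq_zero_add]
  ring

theorem iterate_oscStep_nonneg (hO : ∀ k, 0 ≤ O k) (hd : ∀ k, 0 ≤ d k) (t k : ℕ) :
    0 ≤ (oscStep O)^[t] d k := by
  induction t generalizing k with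
  | zero => exact hd k
  | succ t ih =>
    rw [Function.iterate_succ_apply']
    exact oscStep_nonneg hO ih k

theorem summable_iterate_oscStep (hO : Summable O) (hd : Summable d) (t : ℕ) :
    Summable ((oscStep O)^[t] d) := by
  induction t with
  | zero => exact hd
  | succ t ih =>
    rw [Function.iterate_succ_apply']
    exact summable_oscStep hO ih

/-- At `k = 0` this is the renewal equation `c t = d t + ∑_{s<t} O (t-1-s) * c s`. -/
theorem iterate_oscStep_apply (O d : ℕ → ℝ) (t k : ℕ) :
    (oscStep O)^[t] d k =
      d (t + k) + ∑ s ∈ Finset.range t, O (t - 1 - s + k) * (oscStep O)^[s] d 0 := by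
  induction t generalizing k with
  | zero => simp
  | succ t ih =>
    rw [Function.iterate_succ_apply', oscStep, ih (k + 1), Finset.sum_range_succ]
    have : ∑ s ∈ Finset.range t, O (t - 1 - s + (k + 1)) * (oscStep O)^[s] d 0 =
        ∑ s ∈ Finset.range t, O (t + 1 - 1 - s + k) * (oscStep O)^[s] d 0 := by
      refine Finset.sum_congr rfl fun s hs => ?_
      have := Finset.mem_range.1 hs
      congr 2
      omega
    rw [this, show t + (k + 1) = t + 1 + k by omega, show t + 1 - 1 - t + k = k by omega]
    ring

/-- Mass balance: each step lowers the total mass by exactly `1 - ∑ O` times the entry at 0, and the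
mass never becomes negative. -/
theorem mul_sum_iterate_oscStep_le (hO : Summable O) (hO0 : ∀ k, 0 ≤ O k) (hd : Summable d)
    (hd0 : ∀ k, 0 ≤ d k) (N : ℕ) :
    (1 - ∑' k, O k) * ∑ t ∈ Finset.range N, (oscStep O)^[t] d 0 ≤ ∑' k, d k := by
  have key : (1 - ∑' k, O k) * ∑ t ∈ Finset.range N, (oscStep O)^[t] d 0 +
      ∑' k, (oscStep O)^[N] d k = ∑' k, d k := by
    induction N with
    | zero => simp
    | succ N ih =>
      rw [Finset.sum_range_succ, Function.iterate_succ_apply',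
        tsum_oscStep hO (summable_iterate_oscStep hO hd N), ← ih]
      ring
  have : 0 ≤ ∑' k, (oscStep O)^[N] d k := tsum_nonneg (iterate_oscStep_nonneg hO0 hd0 N)
  linarith

/-- Convexity of the square. The renewal equation writes `c t` as a combination of `d t / Δ` and the
earlier `c s`, with weights `Δ` and `O (t-1-s)` of total at most 1. Hence the squares satisfy the
same recursion as an inequality, with source `d² / Δ`. -/
theorem sq_iterate_oscStep_le (hO : Summable O) (hO0 : ∀ k, 0 ≤ O k) (hρ : ∑' k, O k < 1) (t : ℕ) :
    ((oscStep O)^[t] d 0) ^ 2 ≤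
      (oscStep O)^[t] (fun k => d k ^ 2 / (1 - ∑' k, O k)) 0 := by
  induction t using Nat.strong_induction_on with
  | _ t ih =>
    have hΔ : 0 < 1 - ∑' k, O k := sub_pos.2 hρ
    set Δ := 1 - ∑' k, O k with hΔdef
    rw [iterate_oscStep_apply O (fun k => d k ^ 2 / Δ) t 0]
    simp only [add_zero]
    set m := (oscStep O)^[t] d 0 with hm
    have hm' := iterate_oscStep_apply O d t 0
    simp only [add_zero] at hm'
    rw [← hm] at hm'
    -- Convexity is used through the tangent at `m`: `x² ≥ 2xm - m²`, here at `x = d t / Δ` with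
    -- weight `Δ`, then at each `x = c s`.
    have h1 : 2 * d t * m - Δ * m ^ 2 ≤ d t ^ 2 / Δ := by
      rw [le_div_iff₀ hΔ]
      nlinarith [sq_nonneg (d t - Δ * m)]
    have h2 : ∑ s ∈ Finset.range t,
        (O (t - 1 - s) * (oscStep O)^[s] d 0 * (2 * m) - O (t - 1 - s) * m ^ 2) ≤
        ∑ s ∈ Finset.range t, O (t - 1 - s) * (oscStep O)^[s] (fun k => d k ^ 2 / Δ) 0 := by
      refine Finset.sum_le_sum fun s hs => ?_
      have h3 := ih s (Finset.mem_range.1 hs)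
      have h4 : (oscStep O)^[s] d 0 * (2 * m) - m ^ 2 ≤
          (oscStep O)^[s] (fun k => d k ^ 2 / Δ) 0 := by
        nlinarith [sq_nonneg ((oscStep O)^[s] d 0 - m)]
      nlinarith [mul_le_mul_of_nonneg_left h4 (hO0 (t - 1 - s))]
    rw [Finset.sum_sub_distrib, ← Finset.sum_mul, ← Finset.sum_mul,
      Finset.sum_range_reflect (fun j => O j) t] at h2
    have h5 : ∑ j ∈ Finset.range t, O j ≤ 1 - Δ := by
      rw [hΔdef, sub_sub_cancel]
      exact hO.sum_le_tsum _ fun i _ => hO0 i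
    rw [eq_sub_of_add_eq' hm'.symm] at h2
    nlinarith [mul_le_mul_of_nonneg_right h5 (sq_nonneg m)]

/-- One factor `Δ⁻¹` comes from the source `d² / Δ`, the other from the mass balance. -/
theorem sum_sq_iterate_oscStep_le (hO : Summable O) (hO0 : ∀ k, 0 ≤ O k) (hρ : ∑' k, O k < 1)
    (hd : Summable fun k => d k ^ 2) (N : ℕ) :
    ∑ t ∈ Finset.range N, ((oscStep O)^[t] d 0) ^ 2 ≤
      ((1 - ∑' k, O k) ^ 2)⁻¹ * ∑' k, d k ^ 2 := by
  have hΔ : 0 < 1 - ∑' k, O k := sub_pos.2 hρ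
  have h1 := mul_sum_iterate_oscStep_le hO hO0 (hd.div_const (1 - ∑' k, O k))
    (fun k => div_nonneg (sq_nonneg _) hΔ.le) N
  have h2 := Finset.sum_le_sum fun t (_ : t ∈ Finset.range N) =>
    sq_iterate_oscStep_le (d := d) hO hO0 hρ t
  refine h2.trans ?_
  rw [tsum_div_const, mul_comm, ← le_div_iff₀ hΔ] at h1
  refine h1.trans (le_of_eq ?_)
  field_simp

/-- The mass at time `t` is a tail of `d` plus the convolution of `c` with the tails of `O`. By the
mass balance `c` is summable, and the tails of `O` are bounded and tend to 0, so dominated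
convergence applies. -/
theorem tendsto_tsum_iterate_oscStep (hO : Summable O) (hO0 : ∀ k, 0 ≤ O k) (hρ : ∑' k, O k < 1)
    (hd : Summable d) (hd0 : ∀ k, 0 ≤ d k) :
    Tendsto (fun t => ∑' k, (oscStep O)^[t] d k) atTop (𝓝 0) := by
  have hΔ : 0 < 1 - ∑' k, O k := sub_pos.2 hρ
  set c : ℕ → ℝ := fun t => (oscStep O)^[t] d 0 with hc
  have hc0 : ∀ t, 0 ≤ c t := fun t => iterate_oscStep_nonneg hO0 hd0 t 0
  have hcs : Summable c := by
    refine summable_of_sum_range_le (c := (∑' k, d k) / (1 - ∑' k, O k)) hc0 fun N => ?_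
    have := mul_sum_iterate_oscStep_le hO hO0 hd hd0 N
    rwa [mul_comm, ← le_div_iff₀ hΔ] at this
  set tail : ℕ → ℝ := fun j => ∑' k, O (j + k) with htail
  have hOs : ∀ j, Summable fun k => O (j + k) := fun j => by
    simpa only [add_comm j] using (summable_nat_add_iff j).2 hO
  have htend : ∀ {e : ℕ → ℝ}, Tendsto (fun j => ∑' k, e (j + k)) atTop (𝓝 0) := by
    intro e
    simpa only [add_comm] using tendsto_sum_nat_add e
  have htail1 : ∀ j, tail j ≤ ∑' k, O k := fun j => by
    have h := hO.sum_add_tsum_nat_add j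
    have h' : 0 ≤ ∑ i ∈ Finset.range j, O i := Finset.sum_nonneg fun i _ => hO0 i
    simp only [htail, add_comm j]
    linarith
  have htail0 : ∀ j, 0 ≤ tail j := fun j => tsum_nonneg fun k => hO0 _
  have hsum : ∀ t, ∑' k, (oscStep O)^[t] d k =
      ∑' k, d (t + k) + ∑' s, (if s < t then tail (t - 1 - s) * c s else 0) := by
    intro t
    have h1 : Summable fun k => d (t + k) := by
      simpa only [add_comm t] using (summable_nat_add_iff t).2 hd
    have h2 : ∀ s ∈ Finset.range t, Summable fun k => O (t - 1 - s + k) * c s :=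
      fun s _ => (hOs _).mul_right _
    have h3 : ∑' s, (if s < t then tail (t - 1 - s) * c s else 0) =
        ∑ s ∈ Finset.range t, tail (t - 1 - s) * c s := by
      rw [tsum_eq_sum (s := Finset.range t)]
      · exact Finset.sum_congr rfl fun s hs => if_pos (Finset.mem_range.1 hs)
      · intro s hs
        exact if_neg fun h => hs (Finset.mem_range.2 h)
    rw [tsum_congr (iterate_oscStep_apply O d t), h1.tsum_add (summable_sum h2),
      Summable.tsum_finsetSum h2, h3]
    simp only [tsum_mul_right, htail]
  have hdc : Tendsto (fun t => ∑' s, (if s < t then tail (t - 1 - s) * c s else 0)) atTop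
      (𝓝 (∑' _ : ℕ, (0 : ℝ))) := by
    refine tendsto_tsum_of_dominated_convergence (bound := fun s => (∑' k, O k) * c s)
      (hcs.mul_left _) (fun s => ?_) (Eventually.of_forall fun t s => ?_)
    · have h1 : Tendsto (fun t => tail (t - 1 - s) * c s) atTop (𝓝 (0 * c s)) := by
        refine Tendsto.mul_const _ (Tendsto.comp (g := tail) htend ?_)
        simp only [Nat.sub_sub]
        exact tendsto_sub_atTop_nat _
      rw [zero_mul] at h1
      refine h1.congr' ?_
      filter_upwards [eventually_gt_atTop s] with t ht
      rw [if_pos ht]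
    · split_ifs
      · rw [Real.norm_of_nonneg (mul_nonneg (htail0 _) (hc0 s))]
        exact mul_le_mul_of_nonneg_right (htail1 _) (hc0 s)
      · simpa using mul_nonneg (tsum_nonneg hO0) (hc0 s)
  simp only [hsum]
  simpa using (htend (e := d)).add hdc

end Sequences

end SCUM

namespace SCUM

/-! ### The transfer operator and its effect on oscillations -/

section Transfer

open Filter Topology

variable {A : Type*}

/-- The past obtained by appending the symbol `a` after the past `x`. -/
def pastCons (a : A) (x : Past A) : Past A
  | 0 => a
  | k + 1 => x k

@[simp] theorem pastCons_zero (a : A) (x : Past A) : pastCons a x 0 = a := rfl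

@[simp] theorem pastCons_succ (a : A) (x : Past A) (k : ℕ) : pastCons a x (k + 1) = x k := rfl

/-- The transfer operator `(L h)(x) = ∑_a g(a | x) h(x a)`. -/
noncomputable def PastKernel.transfer (g : PastKernel A) (h : Past A → ℝ) (x : Past A) : ℝ :=
  ∑' a, g.prob a x * h (pastCons a x)

/-- The oscillations of the kernel as real numbers; `g.osc k` is the oscillation in the `k`-th
most recent symbol. -/
noncomputable def PastKernel.osc (g : PastKernel A) (k : ℕ) : ℝ := (g.Osc (k + 1)).toReal

namespace PastKernel

variable (g : PastKernel A)

theorem osc_nonneg (k : ℕ) : 0 ≤ g.osc k := ENNReal.toReal_nonneg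

theorem summable_prob_mul (x : Past A) {u : A → ℝ} {M : ℝ} (hu : ∀ a, |u a| ≤ M) :
    Summable fun a => g.prob a x * u a := by
  refine Summable.of_norm_bounded ((g.hasSum_one x).summable.mul_right M) fun a => ?_
  rw [Real.norm_eq_abs, abs_mul, abs_of_nonneg (g.nonneg a x)]
  exact mul_le_mul_of_nonneg_left (hu a) (g.nonneg a x)

theorem tsum_prob_mul_const (x : Past A) (c : ℝ) : ∑' a, g.prob a x * c = c := by
  rw [tsum_mul_right, (g.hasSum_one x).tsum_eq, one_mul]

theorem abs_tsum_prob_mul_le (x : Past A) {u : A → ℝ} {M : ℝ} (hu : ∀ a, |u a| ≤ M) :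
    |∑' a, g.prob a x * u a| ≤ M := by
  have hs := g.summable_prob_mul x hu
  have hM : Summable fun a => g.prob a x * M := (g.hasSum_one x).summable.mul_right M
  have hle : ∀ a, |g.prob a x * u a| ≤ g.prob a x * M := fun a => by
    rw [abs_mul, abs_of_nonneg (g.nonneg a x)]
    exact mul_le_mul_of_nonneg_left (hu a) (g.nonneg a x)
  rw [← g.tsum_prob_mul_const x M, abs_le]
  constructor
  · rw [← tsum_neg]
    exact hM.neg.tsum_le_tsum (fun a => (abs_le.1 (hle a)).1) hs
  · exact hs.tsum_le_tsum (fun a => (abs_le.1 (hle a)).2) hM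

theorem abs_transfer_le {h : Past A → ℝ} {M : ℝ} (hh : ∀ x, |h x| ≤ M) (x : Past A) :
    |g.transfer h x| ≤ M :=
  g.abs_tsum_prob_mul_le x fun _ => hh _

theorem abs_iterate_transfer_le {h : Past A → ℝ} {M : ℝ} (hh : ∀ x, |h x| ≤ M) (t : ℕ)
    (x : Past A) : |g.transfer^[t] h x| ≤ M := by
  induction t generalizing x with
  | zero => exact hh x
  | succ t ih =>
    rw [Function.iterate_succ_apply']
    exact g.abs_transfer_le ih x

variable {g}

theorem tsum_Osc_lt_one (hΔ : 0 < g.Delta) : ∑' j : ℕ, g.Osc (j + 1) < 1 := by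
  by_contra! hcon
  have h1 : (1 : EReal) ≤ ((∑' j : ℕ, g.Osc (j + 1) : ℝ≥0∞) : EReal) := by exact_mod_cast hcon
  have h2 : g.Delta ≤ 0 := by
    rw [Delta, EReal.sub_nonpos]
    exact h1
  exact absurd hΔ (not_lt.2 h2)

theorem Osc_ne_top (hΔ : 0 < g.Delta) (k : ℕ) : g.Osc (k + 1) ≠ ∞ :=
  ENNReal.ne_top_of_tsum_ne_top ((tsum_Osc_lt_one hΔ).trans ENNReal.one_lt_top).ne k

theorem summable_osc (hΔ : 0 < g.Delta) : Summable g.osc :=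
  ENNReal.summable_toReal ((tsum_Osc_lt_one hΔ).trans ENNReal.one_lt_top).ne

theorem tsum_osc (hΔ : 0 < g.Delta) : ∑' k, g.osc k = (∑' j : ℕ, g.Osc (j + 1)).toReal :=
  (ENNReal.tsum_toReal_eq (Osc_ne_top hΔ)).symm

theorem tsum_osc_lt_one (hΔ : 0 < g.Delta) : ∑' k, g.osc k < 1 := by
  rw [tsum_osc hΔ]
  simpa using (ENNReal.toReal_lt_toReal ((tsum_Osc_lt_one hΔ).trans ENNReal.one_lt_top).ne
    ENNReal.one_ne_top).2 (tsum_Osc_lt_one hΔ)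

theorem toReal_Delta (hΔ : 0 < g.Delta) : g.Delta.toReal = 1 - ∑' k, g.osc k := by
  have hS := ((tsum_Osc_lt_one hΔ).trans ENNReal.one_lt_top).ne
  rw [tsum_osc hΔ, Delta, EReal.toReal_sub]
  · simp
  · exact EReal.coe_ne_top 1
  · exact EReal.coe_ne_bot 1
  · simpa using hS
  · exact EReal.coe_ennreal_ne_bot _

theorem sum_abs_prob_sub_le (hΔ : 0 < g.Delta) (k : ℕ) {z z' : Past A}
    (hz : ∀ i, i ≠ k → z i = z' i) (S : Finset A) :
    ∑ a ∈ S, |g.prob a z - g.prob a z'| ≤ 2 * g.osc k := by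
  have h1 : (1 / 2) * ∑' a, ENNReal.ofReal |g.prob a z - g.prob a z'| ≤ g.Osc (k + 1) :=
    le_iSup_of_le z <| le_iSup_of_le z' <| le_iSup_of_le (fun i hi => hz i (by omega)) le_rfl
  have h2 : (1 / 2) * ENNReal.ofReal (∑ a ∈ S, |g.prob a z - g.prob a z'|) ≤ g.Osc (k + 1) := by
    refine le_trans ?_ h1
    rw [ENNReal.ofReal_sum_of_nonneg fun _ _ => abs_nonneg _]
    gcongr
    exact ENNReal.sum_le_tsum S
  have h3 := ENNReal.toReal_mono (Osc_ne_top hΔ k) h2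
  rw [ENNReal.toReal_mul, ENNReal.toReal_ofReal (Finset.sum_nonneg fun _ _ => abs_nonneg _)] at h3
  simp only [one_div, ENNReal.toReal_inv, ENNReal.toReal_ofNat] at h3
  unfold osc
  linarith

end PastKernel

/-- Changing finitely many coordinates one at a time. -/
theorem abs_sub_piecewise_le {ι : Type*} [DecidableEq ι] (F : (ι → A) → ℝ) (b : ι → ℝ)
    (hF : ∀ w w' j, (∀ i, i ≠ j → w i = w' i) → |F w - F w'| ≤ b j) (w w' : ι → A)
    (S : Finset ι) :
    |F w - F (S.piecewise w' w)| ≤ ∑ j ∈ S, {k | w k ≠ w' k}.indicator b j := by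
  induction S using Finset.induction_on with
  | empty => simp
  | insert j S hj ih =>
    rw [Finset.sum_insert hj, Finset.piecewise_insert]
    have h1 : |F (S.piecewise w' w) - F (Function.update (S.piecewise w' w) j (w' j))| ≤
        {k | w k ≠ w' k}.indicator b j := by
      by_cases h : w j = w' j
      · have h2 : Function.update (S.piecewise w' w) j (w' j) = S.piecewise w' w := by
          rw [Function.update_eq_self_iff, Finset.piecewise_eq_of_notMem _ _ _ hj, h]
        simp [h2, h]
      · rw [Set.indicator_of_mem (by exact h)]
        exact hF _ _ j fun i hi => (Function.update_of_ne hi _ _).symm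
    have h3 := abs_sub_le (F w) (F (S.piecewise w' w))
      (F (Function.update (S.piecewise w' w) j (w' j)))
    linarith

/-- Turn `z` into `z'` one coordinate at a time. Continuity carries the bound over to infinitely
many changes; it is used on finite sums over `S`, which are continuous because each `g.prob a` is.
-/
theorem PastKernel.abs_tsum_prob_mul_sub_le [TopologicalSpace A] {g : PastKernel A}
    (hcont : g.IsContinuous) (hΔ : 0 < g.Delta) {v : A → ℝ} {B : ℝ} (hv : ∀ a, |v a| ≤ B)
    (z z' : Past A) :
    |∑' a, g.prob a z * v a - ∑' a, g.prob a z' * v a| ≤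
      2 * B * ∑' k, {k | z k ≠ z' k}.indicator g.osc k := by
  have hfin : ∀ S : Finset A, |∑ a ∈ S, g.prob a z * v a - ∑ a ∈ S, g.prob a z' * v a| ≤
      2 * B * ∑' k, {k | z k ≠ z' k}.indicator g.osc k := by
    intro S
    rcases S.eq_empty_or_nonempty with rfl | ⟨a₀, -⟩
    · by_cases hA : Nonempty A
      · obtain ⟨a⟩ := hA
        have hB : 0 ≤ B := (abs_nonneg _).trans (hv a)
        simpa using mul_nonneg (mul_nonneg zero_le_two hB)
          (tsum_nonneg fun k => Set.indicator_nonneg (fun k _ => g.osc_nonneg k) k)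
      · exact (hA ⟨z 0⟩).elim
    have hB : 0 ≤ B := (abs_nonneg _).trans (hv a₀)
    set F : Past A → ℝ := fun x => ∑ a ∈ S, g.prob a x * v a with hFdef
    have hFc : Continuous F := continuous_finsetSum _ fun a _ => (hcont a).mul continuous_const
    have hF : ∀ w w' j, (∀ i, i ≠ j → w i = w' i) → |F w - F w'| ≤ 2 * B * g.osc j := by
      intro w w' j hw
      rw [hFdef]
      simp only
      rw [← Finset.sum_sub_distrib]
      refine (Finset.abs_sum_le_sum_abs _ _).trans ?_
      have h1 : ∀ a ∈ S, |g.prob a w * v a - g.prob a w' * v a| ≤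
          |g.prob a w - g.prob a w'| * B := fun a _ => by
        rw [← sub_mul, abs_mul]
        exact mul_le_mul_of_nonneg_left (hv a) (abs_nonneg _)
      refine (Finset.sum_le_sum h1).trans ?_
      rw [← Finset.sum_mul]
      nlinarith [mul_le_mul_of_nonneg_right (sum_abs_prob_sub_le hΔ j hw S) hB]
    have hsum : Summable ({k | z k ≠ z' k}.indicator fun k => 2 * B * g.osc k) :=
      ((summable_osc hΔ).mul_left _).indicator _
    have hK : ∀ K : ℕ, |F z - F ((Finset.range K).piecewise z' z)| ≤
        ∑' k, {k | z k ≠ z' k}.indicator (fun k => 2 * B * g.osc k) k := fun K =>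
      (abs_sub_piecewise_le F _ hF z z' _).trans (hsum.sum_le_tsum _ fun k _ =>
        Set.indicator_nonneg
          (fun k _ => mul_nonneg (mul_nonneg zero_le_two hB) (g.osc_nonneg k)) k)
    have hlim : Tendsto (fun K : ℕ => (Finset.range K).piecewise z' z) atTop (𝓝 z') := by
      refine tendsto_pi_nhds.2 fun k => tendsto_const_nhds.congr' ?_
      filter_upwards [eventually_gt_atTop k] with K hk
      rw [Finset.piecewise_eq_of_mem _ _ _ (Finset.mem_range.2 hk)]
    have hlim' := ((hFc.tendsto z').comp hlim).const_sub (F z) |>.abs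
    have h2 := le_of_tendsto hlim' (Eventually.of_forall hK)
    refine h2.trans (le_of_eq ?_)
    rw [← tsum_mul_left]
    refine tsum_congr fun k => ?_
    by_cases hk : z k = z' k <;> simp [hk]
  exact le_of_tendsto (((g.summable_prob_mul z hv).hasSum.sub
    (g.summable_prob_mul z' hv).hasSum).abs.congr fun S => by rw [Finset.sum_sub_distrib])
    (Eventually.of_forall hfin)

/-- `d k` bounds the oscillation of `h` in the `k`-th most recent symbol, jointly over all
symbols. -/
def HasOscBound (h : Past A → ℝ) (d : ℕ → ℝ) : Prop :=
  ∀ x x', |h x - h x'| ≤ ∑' k, {k | x k ≠ x' k}.indicator d k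

theorem HasOscBound.abs_sub_le_tsum {h : Past A → ℝ} {d : ℕ → ℝ} (hh : HasOscBound h d)
    (hd : Summable d) (hd0 : ∀ k, 0 ≤ d k) (x x' : Past A) : |h x - h x'| ≤ ∑' k, d k :=
  (hh x x').trans <| (hd.indicator _).tsum_le_tsum
    (fun k => Set.indicator_le_self' (fun k _ => hd0 k) k) hd

theorem HasOscBound.abs_pastCons_sub_le {h : Past A → ℝ} {d : ℕ → ℝ} (hh : HasOscBound h d)
    (hd : Summable d) (hd0 : ∀ k, 0 ≤ d k) (x : Past A) (a b : A) :
    |h (pastCons a x) - h (pastCons b x)| ≤ d 0 := by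
  refine (hh _ _).trans ?_
  rw [(hd.indicator _).tsum_eq_zero_add]
  simpa using Set.indicator_le_self' (s := {k | pastCons a x k ≠ pastCons b x k})
    (fun k _ => hd0 k) 0

theorem HasOscBound.abs_pastCons_sub_pastCons_le {h : Past A → ℝ} {d : ℕ → ℝ}
    (hh : HasOscBound h d) (hd : Summable d) (x x' : Past A) (a : A) :
    |h (pastCons a x) - h (pastCons a x')| ≤
      ∑' k, {k | x k ≠ x' k}.indicator (fun k => d (k + 1)) k := by
  refine (hh _ _).trans (le_of_eq ?_)
  rw [(hd.indicator _).tsum_eq_zero_add]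
  simp only [pastCons_zero, ne_eq, not_true_eq_false, Set.mem_ofPred_eq, not_false_eq_true,
    Set.indicator_of_notMem, zero_add]
  refine tsum_congr fun k => ?_
  by_cases hk : x k = x' k <;> simp [hk]

/-- A function whose values differ by at most `c` takes its values in an interval of length `c`. -/
theorem exists_forall_mem_Icc_of_abs_sub_le {ι : Type*} [Nonempty ι] {u : ι → ℝ} {c : ℝ}
    (hu : ∀ a b, |u a - u b| ≤ c) : ∃ m, ∀ a, u a ∈ Set.Icc m (m + c) := by
  obtain ⟨a₀⟩ := ‹Nonempty ι›
  have hb : BddBelow (Set.range u) :=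
    ⟨u a₀ - c, by rintro _ ⟨a, rfl⟩; linarith [(abs_le.1 (hu a₀ a)).2]⟩
  have : Nonempty ι := ⟨a₀⟩
  refine ⟨⨅ a, u a, fun a => ⟨ciInf_le hb a, ?_⟩⟩
  have : u a - c ≤ ⨅ b, u b := le_ciInf fun b => by linarith [(abs_le.1 (hu a b)).2]
  linarith

/-- Change first the law of the new symbol, then the past inside `h`. -/
theorem HasOscBound.transfer [TopologicalSpace A] {g : PastKernel A} (hcont : g.IsContinuous)
    (hΔ : 0 < g.Delta) {h : Past A → ℝ} {d : ℕ → ℝ} {M : ℝ} (hM : ∀ x, |h x| ≤ M)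
    (hh : HasOscBound h d) (hd : Summable d) (hd0 : ∀ k, 0 ≤ d k) :
    HasOscBound (g.transfer h) (oscStep g.osc d) := by
  intro x x'
  have : Nonempty A := ⟨x 0⟩
  obtain ⟨m, hm⟩ := exists_forall_mem_Icc_of_abs_sub_le
    (hh.abs_pastCons_sub_le hd hd0 x)
  set D := ∑' k, {k | x k ≠ x' k}.indicator (fun k => d (k + 1)) k with hD
  have hs : ∀ y y', Summable fun a => g.prob a y * h (pastCons a y') :=
    fun y y' => g.summable_prob_mul y fun a => hM _
  have hsc : ∀ y, Summable fun a => g.prob a y * (m + d 0 / 2) :=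
    fun y => (g.hasSum_one y).summable.mul_right _
  have h1 : |∑' a, g.prob a x' * (h (pastCons a x) - h (pastCons a x'))| ≤ D :=
    g.abs_tsum_prob_mul_le x' fun a => hh.abs_pastCons_sub_pastCons_le hd x x' a
  simp only [mul_sub] at h1
  rw [(hs x' x).tsum_sub (hs x' x')] at h1
  -- Both laws have mass 1, so `h` may be centred at the midpoint of its range. This makes `B = d 0
  -- / 2` and gives the sharp coefficient `d 0` of `O k`.
  have h2 := PastKernel.abs_tsum_prob_mul_sub_le hcont hΔ
    (v := fun a => h (pastCons a x) - (m + d 0 / 2)) (B := d 0 / 2)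
    (fun a => abs_le.2 ⟨by linarith [(hm a).1], by linarith [(hm a).2]⟩) x x'
  simp only [mul_sub] at h2
  rw [(hs x x).tsum_sub (hsc x), (hs x' x).tsum_sub (hsc x'), g.tsum_prob_mul_const,
    g.tsum_prob_mul_const] at h2
  have h3 : ∑' k, {k | x k ≠ x' k}.indicator (oscStep g.osc d) k =
      D + 2 * (d 0 / 2) * ∑' k, {k | x k ≠ x' k}.indicator g.osc k := by
    have hd1 : Summable fun k => d (k + 1) := (summable_nat_add_iff 1).2 hd
    rw [hD, ← tsum_mul_left, ← (hd1.indicator _).tsum_add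
      (((PastKernel.summable_osc hΔ).indicator _).mul_left _)]
    refine tsum_congr fun k => ?_
    by_cases hk : x k = x' k
    · simp [hk]
    · simp [hk, oscStep]
      ring
  rw [h3, PastKernel.transfer, PastKernel.transfer]
  rw [abs_le] at h1 h2 ⊢
  constructor <;> linarith [h1.1, h1.2, h2.1, h2.2]

theorem HasOscBound.iterate_transfer [TopologicalSpace A] {g : PastKernel A}
    (hcont : g.IsContinuous) (hΔ : 0 < g.Delta) {h : Past A → ℝ} {d : ℕ → ℝ} {M : ℝ}
    (hM : ∀ x, |h x| ≤ M) (hh : HasOscBound h d) (hd : Summable d) (hd0 : ∀ k, 0 ≤ d k)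
    (t : ℕ) : HasOscBound (g.transfer^[t] h) ((oscStep g.osc)^[t] d) := by
  induction t with
  | zero => exact hh
  | succ t ih =>
    rw [Function.iterate_succ_apply', Function.iterate_succ_apply']
    exact ih.transfer hcont hΔ (g.abs_iterate_transfer_le hM t)
      (summable_iterate_oscStep (PastKernel.summable_osc hΔ) hd t)
      (iterate_oscStep_nonneg g.osc_nonneg hd0 t)

end Transfer

end SCUM

namespace SCUM

/-! ### Compatibility as an integral identity, and Hoeffding's lemma -/

section Measure

open Filter Topology

variable {A : Type*}

theorem pastAt_add_one (m : ℤ) (ω : ℤ → A) :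
    pastAt (m + 1) ω = pastCons (ω m) (pastAt m ω) := by
  funext k
  cases k with
  | zero => simp [pastAt]
  | succ k =>
    simp only [pastAt, pastCons_succ]
    congr 1
    push_cast
    ring

section Measurability

variable [MeasurableSpace A]

theorem measurable_pastCons (a : A) : Measurable (pastCons a : Past A → Past A) := by
  refine measurable_pi_lambda _ fun k => ?_
  cases k with
  | zero => exact measurable_const
  | succ k => exact measurable_pi_apply k

theorem pastSigma_le (m : ℤ) : pastSigma A m ≤ MeasurableSpace.pi :=
  iSup₂_le fun i _ => (measurable_pi_apply i).comap_le

theorem measurable_pastAt_pastSigma (m : ℤ) : Measurable[pastSigma A m] (pastAt m : (ℤ → A) → _) :=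
  @measurable_pi_lambda _ _ _ (pastSigma A m) _ _ fun k => by
    have h : MeasurableSpace.comap (fun ω : ℤ → A => ω (m - 1 - k)) inferInstance ≤
        pastSigma A m :=
      le_iSup₂_of_le (m - 1 - (k : ℤ)) (by omega) le_rfl
    exact Measurable.mono (comap_measurable _) h le_rfl

theorem measurable_pastAt (m : ℤ) : Measurable (pastAt m : (ℤ → A) → Past A) :=
  (measurable_pastAt_pastSigma m).mono (pastSigma_le m) le_rfl

theorem integrable_comp_pastAt {μ : Measure (ℤ → A)} [IsProbabilityMeasure μ]
    {h : Past A → ℝ} (hh : Measurable h) {M : ℝ} (hM : ∀ x, |h x| ≤ M) (m : ℤ) :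
    Integrable (fun ω => h (pastAt m ω)) μ :=
  Integrable.of_bound (hh.comp (measurable_pastAt m)).aestronglyMeasurable M
    (ae_of_all _ fun _ => hM _)

variable [Countable A] [TopologicalSpace A] [DiscreteTopology A] [DiscreteMeasurableSpace A]
  {g : PastKernel A}

theorem PastKernel.IsContinuous.measurable_prob (hcont : g.IsContinuous) (a : A) :
    Measurable (g.prob a) :=
  (hcont a).measurable

theorem PastKernel.IsContinuous.measurable_transfer (hcont : g.IsContinuous) {h : Past A → ℝ}
    (hh : Measurable h) {M : ℝ} (hM : ∀ x, |h x| ≤ M) : Measurable (g.transfer h) := by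
  refine measurable_of_tendsto_metrizable' atTop
    (f := fun (S : Finset A) x => ∑ a ∈ S, g.prob a x * h (pastCons a x)) (fun S => ?_) ?_
  · exact Finset.measurable_fun_sum _ fun a _ =>
      (hcont.measurable_prob a).mul (hh.comp (measurable_pastCons a))
  · exact tendsto_pi_nhds.2 fun x => (g.summable_prob_mul x fun a => hM _).hasSum

theorem PastKernel.IsContinuous.measurable_iterate_transfer (hcont : g.IsContinuous)
    {h : Past A → ℝ} (hh : Measurable h) {M : ℝ} (hM : ∀ x, |h x| ≤ M) (t : ℕ) :
    Measurable (g.transfer^[t] h) := by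
  induction t with
  | zero => exact hh
  | succ t ih =>
    rw [Function.iterate_succ_apply']
    exact hcont.measurable_transfer ih (g.abs_iterate_transfer_le hM t)

variable {μ : Measure (ℤ → A)} [IsProbabilityMeasure μ]

theorem IsCompatible.integral_indicator_mul (hcompat : IsCompatible μ g) {h : Past A → ℝ}
    (hh : Measurable h) {M : ℝ} (hM : ∀ x, |h x| ≤ M) (m : ℤ) (a : A) :
    ∫ ω, h (pastAt m ω) * {ω : ℤ → A | ω m = a}.indicator (fun _ => (1 : ℝ)) ω ∂μ =
      ∫ ω, h (pastAt m ω) * g.prob a (pastAt m ω) ∂μ := by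
  have hset : MeasurableSet {ω : ℤ → A | ω m = a} :=
    (measurableSet_singleton a).preimage (measurable_pi_apply m)
  have hint : Integrable ({ω : ℤ → A | ω m = a}.indicator fun _ => (1 : ℝ)) μ :=
    (integrable_const 1).indicator hset
  have h1 := condExp_stronglyMeasurable_mul_of_bound (μ := μ) (pastSigma_le m)
    (f := fun ω => h (pastAt m ω))
    (hh.comp (measurable_pastAt_pastSigma m)).stronglyMeasurable hint M (ae_of_all _ fun _ => hM _)
  have h2 := integral_condExp (μ := μ) (pastSigma_le (A := A) m)
    (f := (fun ω => h (pastAt m ω)) * {ω : ℤ → A | ω m = a}.indicator fun _ => (1 : ℝ))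
  have h3 : ∫ ω, h (pastAt m ω) * {ω : ℤ → A | ω m = a}.indicator (fun _ => (1 : ℝ)) ω ∂μ =
      ∫ ω, ((fun ω => h (pastAt m ω)) * {ω : ℤ → A | ω m = a}.indicator fun _ => (1 : ℝ)) ω ∂μ :=
    rfl
  rw [h3, ← h2]
  refine integral_congr_ae ?_
  filter_upwards [h1, hcompat m a] with ω h4 h5
  rw [h4, Pi.mul_apply, h5]

/-- Split according to the value of `ω m` and condition each piece on the past. -/
theorem IsCompatible.integral_pastAt_add_one (hcompat : IsCompatible μ g)
    (hcont : g.IsContinuous) {h : Past A → ℝ} (hh : Measurable h) {M : ℝ} (hM : ∀ x, |h x| ≤ M)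
    (m : ℤ) :
    ∫ ω, h (pastAt (m + 1) ω) ∂μ = ∫ ω, g.transfer h (pastAt m ω) ∂μ := by
  have hset : ∀ a, MeasurableSet {ω : ℤ → A | ω m = a} := fun a =>
    (measurableSet_singleton a).preimage (measurable_pi_apply m)
  have hmeas : ∀ a, Measurable fun ω => h (pastCons a (pastAt m ω)) := fun a =>
    hh.comp ((measurable_pastCons a).comp (measurable_pastAt m))
  have hzero : ∀ (ω : ℤ → A) (a : A), a ≠ ω m →
      {ω : ℤ → A | ω m = a}.indicator (fun _ => (1 : ℝ)) ω = 0 := fun ω a ha => by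
    simp [ha.symm]
  have hone : ∀ ω : ℤ → A,
      HasSum (fun a => {ω : ℤ → A | ω m = a}.indicator (fun _ => (1 : ℝ)) ω) 1 := fun ω => by
    have := hasSum_single (f := fun a => {ω : ℤ → A | ω m = a}.indicator (fun _ => (1 : ℝ)) ω)
      (ω m) (hzero ω)
    simpa using this
  have h1 : HasSum (fun a => ∫ ω, h (pastCons a (pastAt m ω)) *
      {ω : ℤ → A | ω m = a}.indicator (fun _ => (1 : ℝ)) ω ∂μ)
      (∫ ω, h (pastAt (m + 1) ω) ∂μ) := by
    refine hasSum_integral_of_dominated_convergence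
      (fun a ω => M * {ω : ℤ → A | ω m = a}.indicator (fun _ => (1 : ℝ)) ω) (fun a => ?_)
      (fun a => ae_of_all _ fun ω => ?_) (ae_of_all _ fun ω => ((hone ω).mul_left M).summable)
      ?_ (ae_of_all _ fun ω => ?_)
    · exact ((hmeas a).mul (measurable_const.indicator (hset a))).aestronglyMeasurable
    · have h0 : 0 ≤ {ω : ℤ → A | ω m = a}.indicator (fun _ => (1 : ℝ)) ω :=
        Set.indicator_nonneg (fun _ _ => zero_le_one) _
      rw [norm_mul, Real.norm_eq_abs, Real.norm_of_nonneg h0]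
      exact mul_le_mul_of_nonneg_right (hM _) h0
    · simp only [fun ω => ((hone ω).mul_left M).tsum_eq]
      exact integrable_const _
    · have := hasSum_single (f := fun a => h (pastCons a (pastAt m ω)) *
        {ω : ℤ → A | ω m = a}.indicator (fun _ => (1 : ℝ)) ω) (ω m) fun a ha => by
          rw [hzero ω a ha, mul_zero]
      simpa [pastAt_add_one] using this
  have h2 : HasSum (fun a => ∫ ω, h (pastCons a (pastAt m ω)) * g.prob a (pastAt m ω) ∂μ)
      (∫ ω, g.transfer h (pastAt m ω) ∂μ) := by
    refine hasSum_integral_of_dominated_convergence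
      (fun a ω => M * g.prob a (pastAt m ω)) (fun a => ?_)
      (fun a => ae_of_all _ fun ω => ?_)
      (ae_of_all _ fun ω => ((g.hasSum_one _).mul_left M).summable) ?_ (ae_of_all _ fun ω => ?_)
    · exact ((hmeas a).mul
        ((hcont.measurable_prob a).comp (measurable_pastAt m))).aestronglyMeasurable
    · rw [norm_mul, Real.norm_eq_abs, Real.norm_of_nonneg (g.nonneg _ _)]
      exact mul_le_mul_of_nonneg_right (hM _) (g.nonneg _ _)
    · simp only [fun ω => ((g.hasSum_one (pastAt m ω)).mul_left M).tsum_eq]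
      exact integrable_const _
    · simp only [mul_comm (h _)]
      exact (g.summable_prob_mul _ fun a => hM _).hasSum
  refine h1.unique ?_
  convert! h2 using 2 with a
  exact hcompat.integral_indicator_mul (hh.comp (measurable_pastCons a)) (fun _ => hM _) m a

theorem IsCompatible.integral_iterate_transfer (hcompat : IsCompatible μ g)
    (hcont : g.IsContinuous) {h : Past A → ℝ} (hh : Measurable h) {M : ℝ} (hM : ∀ x, |h x| ≤ M)
    (m : ℤ) (t : ℕ) :
    ∫ ω, h (pastAt m ω) ∂μ = ∫ ω, g.transfer^[t] h (pastAt (m - t) ω) ∂μ := by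
  induction t with
  | zero => simp
  | succ t ih =>
    rw [ih, Function.iterate_succ_apply', show m - t = m - (t + 1 : ℕ) + 1 by push_cast; ring]
    exact hcompat.integral_pastAt_add_one hcont (hcont.measurable_iterate_transfer hh hM t)
      (g.abs_iterate_transfer_le hM t) _

end Measurability

/-- Hoeffding's lemma for a discrete probability distribution. -/
theorem tsum_mul_exp_le {p : A → ℝ} (hp : ∀ a, 0 ≤ p a) (hp1 : HasSum p 1) {u : A → ℝ} {c : ℝ}
    (hu : ∀ a b, |u a - u b| ≤ c) (θ : ℝ) :
    ∑' a, p a * Real.exp (θ * u a) ≤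
      Real.exp (θ * ∑' a, p a * u a + θ ^ 2 * c ^ 2 / 8) := by
  let _ : MeasurableSpace A := ⊤
  have hne : Nonempty A := by
    by_contra hA
    rw [not_nonempty_iff] at hA
    exact zero_ne_one (hasSum_empty.unique hp1)
  obtain ⟨m, hm⟩ := exists_forall_mem_Icc_of_abs_sub_le hu
  have hp1' : HasSum (fun a => ENNReal.ofReal (p a)) 1 := by
    have h := ENNReal.ofReal_tsum_of_nonneg hp hp1.summable
    rw [hp1.tsum_eq, ENNReal.ofReal_one] at h
    rw [h]
    exact ENNReal.summable.hasSum
  set P : PMF A := ⟨fun a => ENNReal.ofReal (p a), hp1'⟩ with hP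
  have hPa : ∀ a, (P a).toReal = p a := fun a => ENNReal.toReal_ofReal (hp a)
  have hint : Integrable u P.toMeasure := by
    refine Integrable.of_bound measurable_from_top.aestronglyMeasurable (|m| + |m + c|)
      (ae_of_all _ fun a => ?_)
    rw [Real.norm_eq_abs]
    refine (abs_le_max_abs_abs (hm a).1 (hm a).2).trans (max_le ?_ ?_) <;>
      linarith [abs_nonneg m, abs_nonneg (m + c)]
  -- The variance proxy is `(c / 2)²`, hence the exponent `θ² c² / 8`.
  have hoeff := ProbabilityTheory.hasSubgaussianMGF_of_mem_Icc (μ := P.toMeasure) (X := u)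
    (a := m) (b := m + c) measurable_from_top.aemeasurable (ae_of_all _ hm)
  have hmean : ∫ a, u a ∂P.toMeasure = ∑' a, p a * u a := by
    rw [PMF.integral_eq_tsum _ _ hint]
    simp only [hPa, smul_eq_mul]
  have h1 := hoeff.mgf_le θ
  have hexp := hoeff.integrable_exp_mul θ
  rw [ProbabilityTheory.mgf, PMF.integral_eq_tsum _ _ hexp, hmean] at h1
  simp only [hPa, smul_eq_mul, mul_sub, Real.exp_sub] at h1
  have h2 : ∀ a, p a * (Real.exp (θ * u a) / Real.exp (θ * ∑' a, p a * u a)) =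
      p a * Real.exp (θ * u a) * (Real.exp (θ * ∑' a, p a * u a))⁻¹ := fun a => by
    rw [div_eq_mul_inv, mul_assoc]
  rw [tsum_congr h2, tsum_mul_right, ← div_eq_mul_inv, div_le_iff₀ (Real.exp_pos _),
    ← Real.exp_add] at h1
  refine h1.trans (Real.exp_le_exp.2 (le_of_eq ?_))
  simp only [add_sub_cancel_left, NNReal.coe_pow, NNReal.coe_div, coe_nnnorm, Real.norm_eq_abs,
    NNReal.coe_ofNat, div_pow, sq_abs]
  ring

theorem HasOscBound.transfer_exp_le {g : PastKernel A} {h : Past A → ℝ} {d : ℕ → ℝ}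
    (hh : HasOscBound h d) (hd : Summable d) (hd0 : ∀ k, 0 ≤ d k) (θ : ℝ) (x : Past A) :
    g.transfer (fun y => Real.exp (θ * h y)) x ≤
      Real.exp (θ * g.transfer h x + θ ^ 2 * d 0 ^ 2 / 8) :=
  tsum_mul_exp_le (fun a => g.nonneg a x) (g.hasSum_one x)
    (fun a b => hh.abs_pastCons_sub_le hd hd0 x a b) θ

end Measure

end SCUM

namespace SCUM

/-! ### Exponential moments for functions of the past -/

section Concentration

open Filter Topology

variable {A : Type*}

theorem abs_exp_mul_le {h : Past A → ℝ} {M : ℝ} (hM : ∀ x, |h x| ≤ M) (θ : ℝ) (x : Past A) :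
    |Real.exp (θ * h x)| ≤ Real.exp (|θ| * M) := by
  rw [Real.abs_exp, Real.exp_le_exp]
  refine (le_abs_self _).trans ?_
  rw [abs_mul]
  exact mul_le_mul_of_nonneg_left (hM x) (abs_nonneg θ)

theorem HasOscBound.abs_sub_integral_pastAt_le [MeasurableSpace A] {μ : Measure (ℤ → A)}
    [IsProbabilityMeasure μ] {h : Past A → ℝ} {d : ℕ → ℝ} {M : ℝ} (hh : Measurable h)
    (hM : ∀ x, |h x| ≤ M) (hosc : HasOscBound h d) (hd : Summable d) (hd0 : ∀ k, 0 ≤ d k)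
    (m : ℤ) (x : Past A) : |h x - ∫ ω, h (pastAt m ω) ∂μ| ≤ ∑' k, d k := by
  have h1 : h x - ∫ ω, h (pastAt m ω) ∂μ = ∫ ω, (h x - h (pastAt m ω)) ∂μ := by
    rw [integral_sub (integrable_const _) (integrable_comp_pastAt hh hM m)]
    simp
  have h2 := norm_integral_le_of_norm_le_const (μ := μ) (f := fun ω => h x - h (pastAt m ω))
    (ae_of_all _ fun ω => hosc.abs_sub_le_tsum hd hd0 x (pastAt m ω))
  rw [h1]
  simpa using h2

section Kernel

variable [Countable A] [TopologicalSpace A] [DiscreteTopology A] [MeasurableSpace A]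
  [DiscreteMeasurableSpace A] {g : PastKernel A} {μ : Measure (ℤ → A)} [IsProbabilityMeasure μ]
  {h : Past A → ℝ} {d : ℕ → ℝ} {M : ℝ}

theorem IsCompatible.integral_exp_pastAt_le (hcompat : IsCompatible μ g) (hcont : g.IsContinuous)
    (hΔ : 0 < g.Delta) (hh : Measurable h) (hM : ∀ x, |h x| ≤ M) (hosc : HasOscBound h d)
    (hd : Summable d) (hd0 : ∀ k, 0 ≤ d k) (m : ℤ) (θ : ℝ) (t : ℕ) :
    ∫ ω, Real.exp (θ * h (pastAt m ω)) ∂μ ≤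
      Real.exp (θ ^ 2 / 8 * ∑ s ∈ Finset.range t, ((oscStep g.osc)^[s] d 0) ^ 2) *
        ∫ ω, Real.exp (θ * g.transfer^[t] h (pastAt (m - t) ω)) ∂μ := by
  induction t with
  | zero => simp
  | succ t ih =>
    refine ih.trans ?_
    set ht := g.transfer^[t] h with hht
    set c := (oscStep g.osc)^[t] d 0 with hc
    have hmeas : Measurable ht := hcont.measurable_iterate_transfer hh hM t
    have hbd : ∀ x, |ht x| ≤ M := g.abs_iterate_transfer_le hM t
    have hsucc : g.transfer^[t + 1] h = g.transfer ht := Function.iterate_succ_apply' _ _ _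
    have hexpmeas : ∀ {k : Past A → ℝ}, Measurable k → Measurable fun x => Real.exp (θ * k x) :=
      fun hk => (hk.const_mul θ).exp
    have hstep : ∫ ω, Real.exp (θ * ht (pastAt (m - t) ω)) ∂μ ≤
        ∫ ω, Real.exp (θ ^ 2 / 8 * c ^ 2) *
          Real.exp (θ * g.transfer ht (pastAt (m - (t + 1 : ℕ)) ω)) ∂μ := by
      rw [show m - t = m - (t + 1 : ℕ) + 1 by push_cast; ring,
        hcompat.integral_pastAt_add_one hcont (h := fun x => Real.exp (θ * ht x)) (hexpmeas hmeas)
          (abs_exp_mul_le hbd θ)]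
      refine integral_mono
        (integrable_comp_pastAt (hcont.measurable_transfer (hexpmeas hmeas) (abs_exp_mul_le hbd θ))
          (g.abs_transfer_le (abs_exp_mul_le hbd θ)) _)
        ((integrable_comp_pastAt (hexpmeas (hcont.measurable_transfer hmeas hbd))
          (abs_exp_mul_le (g.abs_transfer_le hbd) θ) _).const_mul _) fun ω => ?_
      refine ((hosc.iterate_transfer hcont hΔ hM hd hd0 t).transfer_exp_le
        (summable_iterate_oscStep (PastKernel.summable_osc hΔ) hd t)
        (iterate_oscStep_nonneg g.osc_nonneg hd0 t) θ _).trans (le_of_eq ?_)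
      rw [← Real.exp_add]
      congr 1
      ring
    rw [integral_const_mul] at hstep
    refine (mul_le_mul_of_nonneg_left hstep (Real.exp_pos _).le).trans (le_of_eq ?_)
    rw [← mul_assoc, ← Real.exp_add, Finset.sum_range_succ, mul_add, hsucc]

theorem IsCompatible.integral_exp_pastAt_sub_integral_le (hcompat : IsCompatible μ g)
    (hcont : g.IsContinuous) (hΔ : 0 < g.Delta) (hh : Measurable h) (hM : ∀ x, |h x| ≤ M)
    (hosc : HasOscBound h d) (hd : Summable d) (hd0 : ∀ k, 0 ≤ d k)
    (hd2 : Summable fun k => d k ^ 2) (m : ℤ) (θ : ℝ) :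
    ∫ ω, Real.exp (θ * (h (pastAt m ω) - ∫ η, h (pastAt m η) ∂μ)) ∂μ ≤
      Real.exp (θ ^ 2 * (g.Delta.toReal ^ 2)⁻¹ / 8 * ∑' k, d k ^ 2) := by
  set E := ∫ η, h (pastAt m η) ∂μ with hE
  have hO := PastKernel.summable_osc hΔ
  have hρ := PastKernel.tsum_osc_lt_one hΔ
  have hbound : ∀ t : ℕ, ∫ ω, Real.exp (θ * h (pastAt m ω)) ∂μ ≤
      Real.exp (θ ^ 2 * (g.Delta.toReal ^ 2)⁻¹ / 8 * ∑' k, d k ^ 2) *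
        Real.exp (θ * E + |θ| * ∑' k, (oscStep g.osc)^[t] d k) := by
    intro t
    refine (hcompat.integral_exp_pastAt_le hcont hΔ hh hM hosc hd hd0 m θ t).trans ?_
    refine mul_le_mul (Real.exp_le_exp.2 ?_) ?_ (integral_nonneg fun _ => (Real.exp_pos _).le)
      (Real.exp_pos _).le
    · have h1 := sum_sq_iterate_oscStep_le hO g.osc_nonneg hρ hd2 t
      rw [PastKernel.toReal_Delta hΔ]
      refine (mul_le_mul_of_nonneg_left h1 (by positivity)).trans (le_of_eq ?_)
      ring
    · have hmeas := hcont.measurable_iterate_transfer hh hM t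
      have hbd := g.abs_iterate_transfer_le hM t
      have h2 : ∀ ω, Real.exp (θ * g.transfer^[t] h (pastAt (m - t) ω)) ≤
          Real.exp (θ * E + |θ| * ∑' k, (oscStep g.osc)^[t] d k) := fun ω => by
        -- `E` is also the mean of `L^t h`, so `L^t h` differs from `E` by at most its total
        -- oscillation.
        rw [Real.exp_le_exp, hE, hcompat.integral_iterate_transfer hcont hh hM m t,
          ← sub_le_iff_le_add', ← mul_sub]
        refine (le_abs_self _).trans ?_
        rw [abs_mul]
        exact mul_le_mul_of_nonneg_left
          ((hosc.iterate_transfer hcont hΔ hM hd hd0 t).abs_sub_integral_pastAt_le hmeas hbd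
            (summable_iterate_oscStep hO hd t) (iterate_oscStep_nonneg g.osc_nonneg hd0 t) _ _)
          (abs_nonneg θ)
      have h3 := integral_mono (integrable_comp_pastAt (μ := μ) ((hmeas.const_mul θ).exp)
        (abs_exp_mul_le hbd θ) (m - t)) (integrable_const _) h2
      simpa using h3
  have hlim : Tendsto (fun t : ℕ =>
      Real.exp (θ ^ 2 * (g.Delta.toReal ^ 2)⁻¹ / 8 * ∑' k, d k ^ 2) *
        Real.exp (θ * E + |θ| * ∑' k, (oscStep g.osc)^[t] d k)) atTop
      (𝓝 (Real.exp (θ ^ 2 * (g.Delta.toReal ^ 2)⁻¹ / 8 * ∑' k, d k ^ 2) *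
        Real.exp (θ * E + |θ| * 0))) :=
    ((Real.continuous_exp.tendsto _).comp
      (((tendsto_tsum_iterate_oscStep hO g.osc_nonneg hρ hd hd0).const_mul _).const_add _)).const_mul
      _
  have hle := ge_of_tendsto hlim (Eventually.of_forall hbound)
  rw [mul_zero, add_zero] at hle
  simp only [mul_sub, Real.exp_sub]
  rwa [integral_div, div_le_iff₀ (Real.exp_pos _)]

end Kernel

/-! ### Functions of finitely many symbols as functions of the past -/

section Local

variable {n : ℕ} {f : (Fin (n + 1) → A) → ℝ}

/-- A function of `n + 1` symbols as a function of the past, the last symbol being the most recent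
one. -/
def onPast (f : (Fin (n + 1) → A) → ℝ) (x : Past A) : ℝ := f fun i => x (Fin.rev i : ℕ)

/-- The oscillations of `onPast f`. -/
noncomputable def pastDelta (f : (Fin (n + 1) → A) → ℝ) (k : ℕ) : ℝ :=
  if hk : k < n + 1 then (delta f (Fin.rev ⟨k, hk⟩)).toReal else 0

/-- The past strictly before `n + 1` starts with `ω n`; indices are therefore reversed. -/
theorem onSeq_eq_onPast (f : (Fin (n + 1) → A) → ℝ) (ω : ℤ → A) :
    onSeq f ω = onPast f (pastAt (n + 1) ω) := by
  unfold onSeq onPast pastAt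
  congr 1
  funext i
  congr 1
  have := i.isLt
  rw [Fin.val_rev]
  omega

theorem pastDelta_nonneg (f : (Fin (n + 1) → A) → ℝ) (k : ℕ) : 0 ≤ pastDelta f k := by
  unfold pastDelta
  split_ifs
  · exact ENNReal.toReal_nonneg
  · exact le_rfl

theorem pastDelta_rev (f : (Fin (n + 1) → A) → ℝ) (j : Fin (n + 1)) :
    pastDelta f (Fin.rev j) = (delta f j).toReal := by
  rw [pastDelta, dif_pos (Fin.rev j).isLt, Fin.eta, Fin.rev_rev]

theorem pastDelta_of_notMem_range (f : (Fin (n + 1) → A) → ℝ) {k : ℕ}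
    (hk : k ∉ Finset.range (n + 1)) : pastDelta f k = 0 :=
  dif_neg fun h => hk (Finset.mem_range.2 h)

theorem summable_pastDelta (f : (Fin (n + 1) → A) → ℝ) : Summable (pastDelta f) :=
  summable_of_ne_finset_zero fun _ => pastDelta_of_notMem_range f

theorem summable_pastDelta_sq (f : (Fin (n + 1) → A) → ℝ) : Summable fun k => pastDelta f k ^ 2 :=
  summable_of_ne_finset_zero (s := Finset.range (n + 1)) fun k hk => by
    rw [pastDelta_of_notMem_range f hk, sq, zero_mul]

theorem sum_comp_rev {n : ℕ} (φ : ℕ → ℝ) :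
    ∑ j : Fin (n + 1), φ (Fin.rev j : ℕ) = ∑ k ∈ Finset.range (n + 1), φ k := by
  rw [Finset.sum_range]
  exact Fintype.sum_equiv Fin.revPerm _ _ fun _ => rfl

theorem tsum_pastDelta_sq (f : (Fin (n + 1) → A) → ℝ) :
    ∑' k, pastDelta f k ^ 2 = deltaNormSq f := by
  rw [tsum_eq_sum (s := Finset.range (n + 1)) fun k hk => by
    rw [pastDelta_of_notMem_range f hk, sq, zero_mul], ← sum_comp_rev]
  simp only [pastDelta_rev, deltaNormSq]

theorem abs_sub_le_delta (hf : f ∈ localClass A n) (w w' : Fin (n + 1) → A) (j : Fin (n + 1))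
    (hw : ∀ i, i ≠ j → w i = w' i) : |f w - f w'| ≤ (delta f j).toReal := by
  have h1 : ENNReal.ofReal |f (Function.update w j (w j)) - f (Function.update w j (w' j))| ≤
      delta f j :=
    le_iSup_of_le w <| le_iSup_of_le (w j) <| le_iSup_of_le (w' j) le_rfl
  have h2 : Function.update w j (w' j) = w' := by
    funext i
    by_cases hi : i = j
    · subst hi
      simp
    · rw [Function.update_of_ne hi, hw i hi]
  rw [Function.update_eq_self, h2] at h1
  exact (ENNReal.ofReal_le_iff_le_toReal (hf j).ne).1 h1

theorem hasOscBound_onPast (hf : f ∈ localClass A n) : HasOscBound (onPast f) (pastDelta f) := by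
  intro x x'
  have h1 := abs_sub_piecewise_le f (fun j => (delta f j).toReal) (abs_sub_le_delta hf)
    (fun i => x (Fin.rev i : ℕ)) (fun i => x' (Fin.rev i : ℕ)) Finset.univ
  rw [Finset.piecewise_univ] at h1
  refine h1.trans (le_of_eq ?_)
  rw [tsum_eq_sum (s := Finset.range (n + 1)) fun k hk => by
    rw [Set.indicator_apply_eq_zero]
    exact fun _ => pastDelta_of_notMem_range f hk,
    ← sum_comp_rev]
  refine Finset.sum_congr rfl fun j _ => ?_
  by_cases hj : x (Fin.rev j : ℕ) = x' (Fin.rev j : ℕ)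
  · rw [Set.indicator_of_notMem (by simpa using hj), Set.indicator_of_notMem (by simpa using hj)]
  · rw [Set.indicator_of_mem (by exact hj), Set.indicator_of_mem (by exact hj), pastDelta_rev]

/-- Finitely many finite oscillations force boundedness, which yields every integrability claim. -/
theorem exists_forall_abs_onPast_le (hf : f ∈ localClass A n) : ∃ M, ∀ x, |onPast f x| ≤ M := by
  rcases isEmpty_or_nonempty A with hA | ⟨⟨a⟩⟩
  · exact ⟨0, fun x => hA.elim (x 0)⟩
  · refine ⟨|onPast f fun _ => a| + ∑' k, pastDelta f k, fun x => ?_⟩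
    have h1 := (hasOscBound_onPast hf).abs_sub_le_tsum (summable_pastDelta f)
      (pastDelta_nonneg f) x fun _ => a
    have h2 := abs_sub_abs_le_abs_sub (onPast f x) (onPast f fun _ => a)
    linarith

theorem measurable_onPast [Countable A] [MeasurableSpace A] [DiscreteMeasurableSpace A]
    (f : (Fin (n + 1) → A) → ℝ) : Measurable (onPast f) :=
  (measurable_of_countable f).comp (measurable_pi_lambda _ fun _ => measurable_pi_apply _)

theorem onPast_eq_of_deltaNormSq_eq_zero (hf : f ∈ localClass A n) (h0 : deltaNormSq f = 0)
    (x x' : Past A) : onPast f x = onPast f x' := by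
  have h1 : ∀ k, pastDelta f k = 0 := fun k => by
    have h2 := (summable_pastDelta_sq f).le_tsum k fun j _ => sq_nonneg _
    rw [tsum_pastDelta_sq, h0] at h2
    exact pow_eq_zero_iff two_ne_zero |>.1 (le_antisymm h2 (sq_nonneg _))
  have h2 := (hasOscBound_onPast hf).abs_sub_le_tsum (summable_pastDelta f)
    (pastDelta_nonneg f) x x'
  simp only [h1, tsum_zero] at h2
  exact sub_eq_zero.1 (abs_eq_zero.1 (le_antisymm h2 (abs_nonneg _)))

end Local

end Concentration

end SCUM

/-! ### The concentration inequality -/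

theorem mainTheorem2 {A : Type*} [Countable A] [TopologicalSpace A] [DiscreteTopology A]
    [MeasurableSpace A] [DiscreteMeasurableSpace A]
    (g : SCUM.PastKernel A) (hcont : g.IsContinuous) (hΔ : 0 < g.Delta)
    (μ : Measure (ℤ → A)) [IsProbabilityMeasure μ]
    (hshift : μ.map SCUM.shift = μ) (hcompat : SCUM.IsCompatible μ g)
    (n : ℕ) (f : (Fin (n + 1) → A) → ℝ) (hf : f ∈ SCUM.localClass A n) :
    Integrable (SCUM.onSeq f) μ ∧
    (∀ θ : ℝ,
      Integrable (fun ω => Real.exp (θ * (SCUM.onSeq f ω - ∫ η, SCUM.onSeq f η ∂μ))) μ ∧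
      ∫ ω, Real.exp (θ * (SCUM.onSeq f ω - ∫ η, SCUM.onSeq f η ∂μ)) ∂μ ≤
        Real.exp (θ ^ 2 * (g.Delta.toReal ^ 2)⁻¹ / 8 * SCUM.deltaNormSq f)) ∧
    (∀ u : ℝ, 0 < u →
      μ.real {ω | u < |SCUM.onSeq f ω - ∫ η, SCUM.onSeq f η ∂μ|} ≤
        2 * Real.exp (-(2 * u ^ 2 / ((g.Delta.toReal ^ 2)⁻¹ * SCUM.deltaNormSq f))) ∧
      (SCUM.deltaNormSq f = 0 →
        μ.real {ω | u < |SCUM.onSeq f ω - ∫ η, SCUM.onSeq f η ∂μ|} = 0)) := by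
  have hseq : SCUM.onSeq f = fun ω => SCUM.onPast f (SCUM.pastAt (n + 1) ω) :=
    funext (SCUM.onSeq_eq_onPast f)
  simp only [hseq]
  obtain ⟨M, hM⟩ := SCUM.exists_forall_abs_onPast_le hf
  have hmeas := SCUM.measurable_onPast f
  set E := ∫ η, SCUM.onPast f (SCUM.pastAt (n + 1) η) ∂μ with hE
  have hint : ∀ θ : ℝ,
      Integrable (fun ω => Real.exp (θ * (SCUM.onPast f (SCUM.pastAt (n + 1) ω) - E))) μ :=
    fun θ => SCUM.integrable_comp_pastAt (h := fun x => Real.exp (θ * (SCUM.onPast f x - E)))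
      (((hmeas.sub_const E).const_mul θ).exp)
      (SCUM.abs_exp_mul_le (h := fun x => SCUM.onPast f x - E) (M := M + |E|)
        (fun x => (abs_sub _ _).trans (add_le_add_left (hM x) _)) θ) _
  have hmgf : ∀ θ : ℝ,
      ∫ ω, Real.exp (θ * (SCUM.onPast f (SCUM.pastAt (n + 1) ω) - E)) ∂μ ≤
        Real.exp (θ ^ 2 * (g.Delta.toReal ^ 2)⁻¹ / 8 * SCUM.deltaNormSq f) := fun θ => by
    rw [← SCUM.tsum_pastDelta_sq f]
    exact hcompat.integral_exp_pastAt_sub_integral_le hcont hΔ hmeas hM (SCUM.hasOscBound_onPast hf)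
      (SCUM.summable_pastDelta f) (SCUM.pastDelta_nonneg f) (SCUM.summable_pastDelta_sq f) _ θ
  refine ⟨SCUM.integrable_comp_pastAt hmeas hM _, fun θ => ⟨hint θ, hmgf θ⟩, fun u hu => ⟨?_, ?_⟩⟩
  · have hV : 0 ≤ (g.Delta.toReal ^ 2)⁻¹ * SCUM.deltaNormSq f :=
      mul_nonneg (by positivity) (Finset.sum_nonneg fun _ _ => sq_nonneg _)
    -- With `V = Δ⁻² ‖δ(f)‖₂²`, the exponent `θ² V / 8` is `(V / 4) θ² / 2`, so the variance proxy
    -- is `V / 4`.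
    have hsub : ProbabilityTheory.HasSubgaussianMGF
        (fun ω => SCUM.onPast f (SCUM.pastAt (n + 1) ω) - E)
        ⟨(g.Delta.toReal ^ 2)⁻¹ * SCUM.deltaNormSq f / 4, by positivity⟩ μ := by
      refine ⟨hint, fun θ => (hmgf θ).trans (Real.exp_le_exp.2 (le_of_eq ?_))⟩
      change _ = (g.Delta.toReal ^ 2)⁻¹ * SCUM.deltaNormSq f / 4 * θ ^ 2 / 2
      ring
    have hup := hsub.measure_ge_le hu.le
    have hdown := hsub.neg.measure_ge_le hu.le
    have hexp : -u ^ 2 / (2 * ((g.Delta.toReal ^ 2)⁻¹ * SCUM.deltaNormSq f / 4)) =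
        -(2 * u ^ 2 / ((g.Delta.toReal ^ 2)⁻¹ * SCUM.deltaNormSq f)) := by
      rw [show 2 * ((g.Delta.toReal ^ 2)⁻¹ * SCUM.deltaNormSq f / 4) =
        (g.Delta.toReal ^ 2)⁻¹ * SCUM.deltaNormSq f / 2 by ring, div_div_eq_mul_div]
      ring
    replace hup := hup.trans_eq (congrArg Real.exp hexp)
    replace hdown := hdown.trans_eq (congrArg Real.exp hexp)
    refine (measureReal_mono (μ := μ) (fun ω hω => ?_) (measure_ne_top _ _)).trans
      ((measureReal_union_le _ _).trans ((add_le_add hup hdown).trans_eq (two_mul _).symm))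
    rcases lt_abs.1 (show u < |_| from hω) with h | h
    · exact Or.inl h.le
    · exact Or.inr h.le
  -- Division by zero makes the bound above equal to 2 here; instead, `f` is constant.
  · intro h0
    have hconst : ∀ ω : ℤ → A, SCUM.onPast f (SCUM.pastAt (n + 1) ω) = E := fun ω => by
      rw [hE, integral_congr_ae (g := fun _ => SCUM.onPast f (SCUM.pastAt (n + 1) ω))
        (ae_of_all _ fun η => SCUM.onPast_eq_of_deltaNormSq_eq_zero hf h0 _ _)]
      simp
    simp [hconst, not_lt.2 hu.le]
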